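/- Let $q>1$, let $\Delta\ge 2$ be an integer, and let $p\in[0,1]$ satisfy $$p<\frac{\Delta-\frac1q-\sqrt{\left(\Delta-\frac1q\right)^2-4\left(1-\frac1q\right)(\Delta-1)}}{2\left(1-\frac1q\right)(\Delta-1)} .$$ For a finite simple graph $(V,F)$, the random cluster model with parameters $p,q$ is the probability distribution on subsets $A\subseteq F$ with $$\pi(A)\propto p^{|A|}(1-p)^{|F\setminus A|}q^{c(A)},$$ where $c(A)$ is the number of connected components of $(V,A)$. Consider the following randomness recycler (RR) algorithm for the random cluster model on a finite simple graph $G=(V,E)$. It keeps edge sets $A_t\subseteq E_t\subseteq E$ and starts from $E_0=A_0=\emptyset$. While $E_t\ne E$, one step does the following. Choose, in any fashion, an oriented edge $e=(v,w)\in E\setminus E_t$, and color it $1$ with probability $p$ and $0$ with probability $1-p$. If $v$ and $w$ are connected in $(V,A_t)$, accept $e$ with this color. If they are not connected, accept the color $0$ always and the color $1$ only with probability $1/q$. On acceptance, $E_{t+1}=E_t\cup\{e\}$, and $A_{t+1}=A_t\cup\{e\}$ or $A_{t+1}=A_t$ according as the color is $1$ or $0$. On rejection, let $C$ be the vertex set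 of the component of $w$ in $(V,A_t)$; remove from $E_t$ and from $A_t$ all edges that have at least one endpoint in $C$; choose, in any fashion, a spanning tree $T$ of the graph with vertex set $C\cup\{v\}$ whose edges are $\{v,w\}$ and the edges of $E_t$ inside $C$; add all edges of $T$ to obtain $E_{t+1}$; draw a sample from the random cluster model with parameters $p,q$ on $T$, and add the edges of $T$ that it contains to obtain $A_{t+1}$. The algorithm stops as soon as $E_t=E$. The choices of $e$ and $T$ may be deterministic or random and may depend on the past. Then the expected number of steps of the algorithm is $O(|E|)$: there is a constant $K<\infty$, depending only on $p$, $q$ and $\Delta$, such that for every finite simple graph $G=(V,E)$ of maximum degree at most $\Delta$, and for every way of making the choices, the expected number of steps until $E_t=E$ is at most $K|E|$. -/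

import Mathlib

open MeasureTheory ProbabilityTheory
open scoped ENNReal

noncomputable section

namespace RandomCluster

universe u

/-- A coin that shows `true` with probability `r` and `false` with probability `1 - r`. -/
def coin (r : ℝ) (h0 : 0 ≤ r) (h1 : r ≤ 1) : PMF Bool :=
  PMF.ofFintype (fun b => if b then ENNReal.ofReal r else ENNReal.ofReal (1 - r)) (by
    simp only [Fintype.sum_bool, if_true, Bool.false_eq_true, if_false]
    rw [← ENNReal.ofReal_add h0 (by linarith)]
    simp)

section Model

variable {V : Type u}

/-- The graph `(V, A)` with vertex set `V` and edge set `A`. -/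
def graphOf (A : Finset (Sym2 V)) : SimpleGraph V :=
  SimpleGraph.fromEdgeSet (A : Set (Sym2 V))

/-- The number `c(A)` of connected components of the graph `(V, A)`. -/
def numComponents (A : Finset (Sym2 V)) : ℕ :=
  Nat.card (graphOf A).ConnectedComponent

variable [DecidableEq V]

/-- The unnormalized weight `p ^ |A| * (1 - p) ^ |F \ A| * q ^ c(A)` of a set `A` of edges in the
random cluster model on the graph `(V, F)`. -/
def rcWeight (p q : ℝ) (F A : Finset (Sym2 V)) : ℝ :=
  p ^ A.card * (1 - p) ^ (F \ A).card * q ^ numComponents A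

theorem rcWeight_sum_ne_zero (p q : ℝ) (hp0 : 0 ≤ p) (hp1 : p ≤ 1) (hq : 0 < q)
    (F : Finset (Sym2 V)) :
    (∑' A : {A : Finset (Sym2 V) // A ⊆ F}, ENNReal.ofReal (rcWeight p q F A.1)) ≠ 0 := by
  intro h
  rw [ENNReal.tsum_eq_zero] at h
  rcases hp1.lt_or_eq with h1 | h1
  · have := h ⟨∅, Finset.empty_subset F⟩
    rw [ENNReal.ofReal_eq_zero] at this
    have hpos : 0 < rcWeight p q F ∅ := by
      have : 0 < 1 - p := by linarith
      unfold rcWeight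
      simp only [Finset.card_empty, pow_zero]
      positivity
    linarith
  · have := h ⟨F, Finset.Subset.refl F⟩
    rw [ENNReal.ofReal_eq_zero] at this
    have hpos : 0 < rcWeight p q F F := by
      unfold rcWeight
      simp only [Finset.sdiff_self, Finset.card_empty, pow_zero]
      subst h1
      positivity
    linarith

theorem rcWeight_sum_ne_top (p q : ℝ) (F : Finset (Sym2 V)) :
    (∑' A : {A : Finset (Sym2 V) // A ⊆ F}, ENNReal.ofReal (rcWeight p q F A.1)) ≠ ∞ := by
  have : Finite {A : Finset (Sym2 V) // A ⊆ F} :=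
    Finite.of_injective (fun A => (⟨A.1, Finset.mem_powerset.2 A.2⟩ : F.powerset)) (by
      intro A B h
      simpa [Subtype.ext_iff] using h)
  have := Fintype.ofFinite {A : Finset (Sym2 V) // A ⊆ F}
  rw [tsum_fintype]
  exact (ENNReal.sum_lt_top.2 fun _ _ => ENNReal.ofReal_lt_top).ne

/-- The random cluster distribution with parameters `p` and `q` on the graph `(V, F)`: the
probability of a set `A ⊆ F` is proportional to
`p ^ |A| * (1 - p) ^ |F \ A| * q ^ c(A)`. -/
def randomCluster (p q : ℝ) (hp0 : 0 ≤ p) (hp1 : p ≤ 1) (hq : 0 < q) (F : Finset (Sym2 V)) :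
    PMF {A : Finset (Sym2 V) // A ⊆ F} :=
  PMF.normalize (fun A => ENNReal.ofReal (rcWeight p q F A.1))
    (rcWeight_sum_ne_zero p q hp0 hp1 hq F) (rcWeight_sum_ne_top p q F)

end Model

section Algorithm

variable {V : Type u} [Fintype V] [DecidableEq V] (G : SimpleGraph V) [DecidableRel G.Adj]

/-- A state `(E_t, A_t)` of the algorithm: `E` is the set of edges on which the current
configuration is random, and `A ⊆ E` is the set of edges colored `1`. -/
@[ext] structure State where
  E : Finset (Sym2 V)
  A : Finset (Sym2 V)
  A_subset : A ⊆ E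
  E_subset : E ⊆ G.edgeFinset

instance : Finite (State G) :=
  Finite.of_injective (fun s : State G => (s.E, s.A)) (by
    intro s t h
    simp only [Prod.mk.injEq] at h
    exact State.ext h.1 h.2)

instance : MeasurableSpace (State G) := ⊤

instance : DiscreteMeasurableSpace (State G) := ⟨fun _ => trivial⟩

variable {G}

namespace State

/-- The initial state: no edge is random, and every edge is colored `0`. -/
def init : State G where
  E := ∅
  A := ∅
  A_subset := Finset.Subset.refl _
  E_subset := Finset.empty_subset _

/-- All edges have been added, that is, the algorithm has terminated. -/
def IsFinal (s : State G) : Prop := s.E = G.edgeFinset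

/-- The vertices `v` and `w` are connected in `(V, A)`. -/
def Joined (s : State G) (v w : V) : Prop := (graphOf s.A).Reachable v w

open Classical in
/-- The vertex set of the component of `w` in `(V, A)`. -/
def comp (s : State G) (w : V) : Finset V := Finset.univ.filter fun x => s.Joined w x

open Classical in
/-- The edges of `F` that have no endpoint in the component of `w` in `(V, A)`; the other edges of
`F` lie in that component or lead out of it. -/
def away (s : State G) (w : V) (F : Finset (Sym2 V)) : Finset (Sym2 V) :=
  F.filter fun f => ∀ x ∈ f, x ∉ s.comp w

open Classical in
/-- The edges of `E` that have both endpoints in the component of `w` in `(V, A)`. -/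
def inside (s : State G) (w : V) : Finset (Sym2 V) :=
  s.E.filter fun f => ∀ x ∈ f, x ∈ s.comp w

/-- `T` is (the edge set of) a spanning tree of the graph that consists of the vertices and edges in
the component of `w`, together with the vertex `v` and the edge `{v, w}`, where `e = (v, w)`. -/
def IsSpanningTree (s : State G) (e : G.Dart) (T : Finset (Sym2 V)) : Prop :=
  T ⊆ insert e.edge (s.inside e.snd) ∧
    ((graphOf T).induce (insert e.fst (s.comp e.snd : Set V))).IsTree

/-- The edge `e` is accepted with color `1` if `b` is true, and with color `0` otherwise. -/
def accept (s : State G) (e : G.Dart) (b : Bool) : State G where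
  E := insert e.edge s.E
  A := if b then insert e.edge s.A else s.A
  A_subset := by
    split
    · exact Finset.insert_subset_insert _ s.A_subset
    · exact s.A_subset.trans (Finset.subset_insert _ _)
  E_subset := by
    apply Finset.insert_subset _ s.E_subset
    rw [SimpleGraph.mem_edgeFinset]
    exact e.edge_mem

/-- The edge `e = (v, w)` is rejected: all edges in the component of `w` or leading out of it are
removed, the spanning tree `T` is added back, and so are the edges in `S ⊆ T` as edges colored
`1`. -/
def reject (s : State G) (e : G.Dart) (T S : Finset (Sym2 V)) (hT : s.IsSpanningTree e T)
    (hS : S ⊆ T) : State G where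
  E := s.away e.snd s.E ∪ T
  A := s.away e.snd s.A ∪ S
  A_subset := by
    classical
    apply Finset.union_subset_union _ hS
    exact Finset.filter_subset_filter _ s.A_subset
  E_subset := by
    classical
    apply Finset.union_subset ((Finset.filter_subset _ _).trans s.E_subset)
    apply hT.1.trans
    apply Finset.insert_subset _ ((Finset.filter_subset _ _).trans s.E_subset)
    rw [SimpleGraph.mem_edgeFinset]
    exact e.edge_mem

end State

variable (G) in
/-- The states at times `0, …, n`. -/
abbrev History (n : ℕ) : Type u := (_ : Finset.Iic n) → State G

/-- The state at time `n`. -/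
def History.last {n : ℕ} (h : History G n) : State G := h ⟨n, Finset.mem_Iic.2 le_rfl⟩

variable (G) in
/-- The choices that the algorithm leaves open, which may be made in any fashion, deterministic or
random, depending on the past: while `E_t` is not the set of all edges, an oriented edge
`e = (v, w)` outside `E_t`; and, when `e` has been rejected, a spanning tree of the component of
`w` together with `{v, w}`. -/
structure ChoiceRule where
  edge : ∀ (n : ℕ) (h : History G n), ¬ h.last.IsFinal → PMF {e : G.Dart // e.edge ∉ h.last.E}
  tree : ∀ (n : ℕ) (h : History G n) (e : G.Dart), e.edge ∉ h.last.E →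
    ¬ h.last.Joined e.fst e.snd → PMF {T : Finset (Sym2 V) // h.last.IsSpanningTree e T}

open Classical in
/-- The law of the state at time `n + 1` given the states up to time `n`. An oriented edge
`e = (v, w)` outside `E_n` is chosen and colored `1` with probability `p`. If `v` and `w` are already
connected, or if the color is `0`, then it is accepted; otherwise it is accepted with probability
`1 / q`, and if it is rejected, then the component of `w` is removed, a spanning tree is added back,
and a sample from the random cluster model on this tree is drawn. The algorithm stays where it is
once it has terminated. -/
def stepLaw (p q : ℝ) (hp0 : 0 ≤ p) (hp1 : p ≤ 1) (hq : 1 < q) (R : ChoiceRule G) (n : ℕ)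
    (h : History G n) : PMF (State G) :=
  if hfin : h.last.IsFinal then PMF.pure h.last
  else
    (R.edge n h hfin).bind fun e =>
      if hj : h.last.Joined e.1.fst e.1.snd then
        (coin p hp0 hp1).map fun b => h.last.accept e.1 b
      else
        (coin p hp0 hp1).bind fun b =>
          if b then
            (coin (1 / q) (by positivity) ((div_le_one (by linarith)).2 hq.le)).bind fun a =>
              if a then PMF.pure (h.last.accept e.1 true)
              else
                (R.tree n h e.1 e.2 hj).bind fun T =>
                  (randomCluster p q hp0 hp1 (by linarith) T.1).map fun S =>
                    h.last.reject e.1 T.1 S.1 T.2 S.2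
          else PMF.pure (h.last.accept e.1 false)

/-- The transition kernel from the states up to time `n` to the state at time `n + 1`. -/
def stepKernel (p q : ℝ) (hp0 : 0 ≤ p) (hp1 : p ≤ 1) (hq : 1 < q) (R : ChoiceRule G) (n : ℕ) :
    Kernel (History G n) (State G) :=
  Kernel.ofFunOfCountable fun h => (stepLaw p q hp0 hp1 hq R n h).toMeasure

instance (p q : ℝ) (hp0 : 0 ≤ p) (hp1 : p ≤ 1) (hq : 1 < q) (R : ChoiceRule G) (n : ℕ) :
    IsMarkovKernel (stepKernel p q hp0 hp1 hq R n) :=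
  ⟨fun h => PMF.toMeasure.isProbabilityMeasure (stepLaw p q hp0 hp1 hq R n h)⟩

/-- The law of the sequence of states of the algorithm, started at `State.init`. -/
def runLaw (p q : ℝ) (hp0 : 0 ≤ p) (hp1 : p ≤ 1) (hq : 1 < q) (R : ChoiceRule G) :
    Measure (ℕ → State G) :=
  Kernel.trajMeasure (X := fun _ => State G) (Measure.dirac State.init)
    (stepKernel p q hp0 hp1 hq R)

/-- The number of steps until all edges have been added, `∞` if this never happens. -/
def numSteps (ω : ℕ → State G) : ℝ≥0∞ := ⨅ (n : ℕ) (_ : (ω n).IsFinal), (n : ℝ≥0∞)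

/-- The expected number of steps of the algorithm. -/
def expectedSteps (p q : ℝ) (hp0 : 0 ≤ p) (hp1 : p ≤ 1) (hq : 1 < q) (R : ChoiceRule G) : ℝ≥0∞ :=
  ∫⁻ ω, numSteps ω ∂(runLaw p q hp0 hp1 hq R)

end Algorithm

end RandomCluster

end

/-! A potential decreases in mean by a fixed amount at every step. It is the number of missing edges
plus `b` times the rank |V| - c(A) of the open edges. It starts at |E|, so a mean decrease of `δ`
per step bounds the expected number of steps by |E| / `δ`.

Accepting an edge lowers the first term by 1, and raises the rank by at most 1, only if the edge is
open and joins two components. Now let a component C with m vertices be rejected. The tree T has m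
edges, of which at least m - 1 were already present inside C. Counting incidences at C, with inside
edges counted twice, at most (Δ - 1)m edges are lost, and T gives m back: the net loss is at most (Δ
- 2)m (`card_E_reject`). The rank loses the m - 1 that C contributed and regains at most the number
of open edges of T (`numComponents_reject`). On a tree an edge is open with probability at most θ =
p / (p + q(1 - p)) (`mean_mem_le`). Thus the mean change is at most (Δ - 2)m - b(m - 1) + bθm, and
the choice b(1 - θ) = Δ - 2 makes this equal to b, whatever the size of C.

Averaging over color and acceptance gives mean decrease at least δ = 1 - p(1 - 1/q) - pb
(`mean_stepLaw_le`). This factors as (1 - p(1 - 1/q))(1 - p(Δ - 1)) / (1 - p), and the hypothesis on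
p says exactly that p(Δ - 1) < 1. -/

noncomputable section

namespace RandomCluster

universe u

/-! ### Components when edges are added -/

section Components

variable {V : Type u}

theorem graphOf_mono {A B : Finset (Sym2 V)} (h : A ⊆ B) : graphOf A ≤ graphOf B :=
  SimpleGraph.fromEdgeSet_mono (by exact_mod_cast h)

theorem graphOf_adj {A : Finset (Sym2 V)} {x y : V} :
    (graphOf A).Adj x y ↔ s(x, y) ∈ A ∧ x ≠ y := by
  simp [graphOf]

theorem numComponents_le_card [Finite V] (A : Finset (Sym2 V)) : numComponents A ≤ Nat.card V :=
  Nat.card_le_card_of_surjective (graphOf A).connectedComponentMk Quot.mk_surjective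

theorem numComponents_empty : numComponents (∅ : Finset (Sym2 V)) = Nat.card V := by
  refine (Nat.card_congr (Equiv.ofBijective
    (graphOf (∅ : Finset (Sym2 V))).connectedComponentMk ⟨?_, Quot.mk_surjective⟩)).symm
  intro x y h
  simpa [graphOf] using SimpleGraph.ConnectedComponent.exact h

variable [DecidableEq V]

/-- One crossing of the new edge suffices: in the induction along a walk, a further crossing either
returns to the component of the start or can replace the earlier one. -/
theorem reachable_insert {A : Finset (Sym2 V)} {v w x y : V}
    (h : (graphOf (insert s(v, w) A)).Reachable x y) :
    (graphOf A).Reachable x y ∨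
      ((graphOf A).Reachable x v ∧ (graphOf A).Reachable w y) ∨
      ((graphOf A).Reachable x w ∧ (graphOf A).Reachable v y) := by
  rw [SimpleGraph.reachable_iff_reflTransGen] at h
  induction h with
  | refl => exact Or.inl (SimpleGraph.Reachable.refl _)
  | @tail y z _ hyz ih =>
    rw [graphOf_adj, Finset.mem_insert] at hyz
    obtain ⟨h1 | h1, hne⟩ := hyz
    · rw [Sym2.eq_iff] at h1
      rcases h1 with ⟨rfl, rfl⟩ | ⟨rfl, rfl⟩
      · rcases ih with h | ⟨h, h'⟩ | ⟨h, h'⟩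
        · exact Or.inr (Or.inl ⟨h, .refl _⟩)
        · exact Or.inr (Or.inl ⟨h, .refl _⟩)
        · exact Or.inl h
      · rcases ih with h | ⟨h, h'⟩ | ⟨h, h'⟩
        · exact Or.inr (Or.inr ⟨h, .refl _⟩)
        · exact Or.inl h
        · exact Or.inr (Or.inr ⟨h, .refl _⟩)
    · have hr : (graphOf A).Reachable y z := (graphOf_adj.2 ⟨h1, hne⟩).reachable
      rcases ih with h | ⟨h, h'⟩ | ⟨h, h'⟩
      · exact Or.inl (h.trans hr)
      · exact Or.inr (Or.inl ⟨h, h'.trans hr⟩)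
      · exact Or.inr (Or.inr ⟨h, h'.trans hr⟩)

variable [Finite V]

theorem numComponents_insert_of_reachable {A : Finset (Sym2 V)} {v w : V}
    (h : (graphOf A).Reachable v w) :
    numComponents A ≤ numComponents (insert s(v, w) A) := by
  refine Nat.card_le_card_of_injective (SimpleGraph.ConnectedComponent.map
    (SimpleGraph.Hom.ofLE (graphOf_mono (Finset.subset_insert s(v, w) A)))) ?_
  intro K L
  induction K using SimpleGraph.ConnectedComponent.ind with | _ x
  induction L using SimpleGraph.ConnectedComponent.ind with | _ y
  intro hKL
  have hr : (graphOf (insert s(v, w) A)).Reachable x y :=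
    SimpleGraph.ConnectedComponent.exact hKL
  apply SimpleGraph.ConnectedComponent.sound
  rcases reachable_insert hr with h1 | ⟨h1, h2⟩ | ⟨h1, h2⟩
  · exact h1
  · exact h1.trans (h.trans h2)
  · exact h1.trans (h.symm.trans h2)

/-- The new edge can only merge the components of its two ends, so components other than that of `w`
keep distinct images. -/
theorem numComponents_le_insert (A : Finset (Sym2 V)) (f : Sym2 V) :
    numComponents A ≤ numComponents (insert f A) + 1 := by
  classical
  induction f using Sym2.ind with | _ v w
  have := Fintype.ofFinite (graphOf A).ConnectedComponent
  have := Fintype.ofFinite (graphOf (insert s(v, w) A)).ConnectedComponent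
  unfold numComponents
  rw [Nat.card_eq_fintype_card, Nat.card_eq_fintype_card, ← Finset.card_univ,
    ← Finset.card_univ, ← Finset.card_erase_add_one
      (Finset.mem_univ ((graphOf A).connectedComponentMk w))]
  refine Nat.add_le_add_right (Finset.card_le_card_of_injOn
    (SimpleGraph.ConnectedComponent.map
      (SimpleGraph.Hom.ofLE (graphOf_mono (Finset.subset_insert s(v, w) A))))
    (fun _ _ => Finset.mem_coe.2 (Finset.mem_univ _)) ?_) 1
  intro K hK L hL
  induction K using SimpleGraph.ConnectedComponent.ind with | _ x
  induction L using SimpleGraph.ConnectedComponent.ind with | _ y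
  intro hKL
  have hr : (graphOf (insert s(v, w) A)).Reachable x y :=
    SimpleGraph.ConnectedComponent.exact hKL
  have hK' : ¬ (graphOf A).Reachable x w := fun h =>
    (Finset.mem_erase.1 hK).1 (SimpleGraph.ConnectedComponent.sound h)
  have hL' : ¬ (graphOf A).Reachable y w := fun h =>
    (Finset.mem_erase.1 hL).1 (SimpleGraph.ConnectedComponent.sound h)
  apply SimpleGraph.ConnectedComponent.sound
  rcases reachable_insert hr with h1 | ⟨h1, h2⟩ | ⟨h1, h2⟩
  · exact h1
  · exact absurd h2.symm hL'
  · exact absurd h1 hK'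

theorem numComponents_le_union (A S : Finset (Sym2 V)) :
    numComponents A ≤ numComponents (A ∪ S) + S.card := by
  induction S using Finset.induction_on with
  | empty => simp
  | insert f S hf ih =>
    have := numComponents_le_insert (A ∪ S) f
    rw [Finset.union_insert, Finset.card_insert_of_notMem hf]
    omega

theorem numComponents_insert_of_not_reachable {A : Finset (Sym2 V)} {v w : V}
    (h : ¬ (graphOf A).Reachable v w) :
    numComponents (insert s(v, w) A) + 1 ≤ numComponents A := by
  classical
  have hle := graphOf_mono (Finset.subset_insert s(v, w) A)
  have := Fintype.ofFinite (graphOf A).ConnectedComponent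
  have := Fintype.ofFinite (graphOf (insert s(v, w) A)).ConnectedComponent
  have hlt : Nat.card (graphOf (insert s(v, w) A)).ConnectedComponent <
      Nat.card (graphOf A).ConnectedComponent := by
    rw [Nat.card_eq_fintype_card, Nat.card_eq_fintype_card]
    refine Fintype.card_lt_of_surjective_not_injective _
      (SimpleGraph.ConnectedComponent.surjective_map_ofLE hle) fun hinj => h ?_
    have hne : v ≠ w := fun hvw => h (hvw ▸ SimpleGraph.Reachable.refl v)
    have hadj : (graphOf (insert s(v, w) A)).Adj v w :=
      graphOf_adj.2 ⟨Finset.mem_insert_self _ _, hne⟩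
    exact SimpleGraph.ConnectedComponent.exact (@hinj ((graphOf A).connectedComponentMk v)
      ((graphOf A).connectedComponentMk w)
      (SimpleGraph.ConnectedComponent.sound hadj.reachable))
  exact hlt

end Components

/-! ### Edges and rank lost in a rejection -/

section Rejection

variable {V : Type u} [Fintype V] {G : SimpleGraph V} [DecidableRel G.Adj]

namespace State

theorem mem_comp {s : State G} {w x : V} : x ∈ s.comp w ↔ s.Joined w x := by
  simp [comp]

theorem self_mem_comp (s : State G) (w : V) : w ∈ s.comp w :=
  mem_comp.2 (SimpleGraph.Reachable.refl w)

variable [DecidableEq V]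

theorem mem_away {s : State G} {w : V} {F : Finset (Sym2 V)} {f : Sym2 V} :
    f ∈ s.away w F ↔ f ∈ F ∧ ∀ x ∈ f, x ∉ s.comp w := by
  simp [away]

theorem mem_inside {s : State G} {w : V} {f : Sym2 V} :
    f ∈ s.inside w ↔ f ∈ s.E ∧ ∀ x ∈ f, x ∈ s.comp w := by
  simp [inside]

/-- Every edge touching the component has been removed, so its vertices are isolated. -/
theorem eq_of_reachable_away {s : State G} {w x y : V} (hx : x ∈ s.comp w)
    (h : (graphOf (s.away w s.A)).Reachable x y) : y = x := by
  rw [SimpleGraph.reachable_iff_reflTransGen] at h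
  induction h with
  | refl => rfl
  | tail _ h ih =>
    subst ih
    exact absurd hx ((mem_away.1 (graphOf_adj.1 h).1).2 _ (Sym2.mem_mk_left _ _))

/-- Representatives of the other components stay pairwise disconnected when edges are removed, and
each vertex of the component of `w` becomes a component of its own. -/
theorem numComponents_away (s : State G) (w : V) :
    numComponents s.A + (s.comp w).card ≤ numComponents (s.away w s.A) + 1 := by
  classical
  have := Fintype.ofFinite (graphOf s.A).ConnectedComponent
  have := Fintype.ofFinite (graphOf (s.away w s.A)).ConnectedComponent
  let K₀ := (graphOf s.A).connectedComponentMk w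
  obtain ⟨out, hout⟩ : ∃ out : (graphOf s.A).ConnectedComponent → V,
      ∀ K, (graphOf s.A).connectedComponentMk (out K) = K :=
    ⟨fun K => Quot.out K, fun K => Quot.out_eq K⟩
  let R : Finset V := (Finset.univ.erase K₀).image out
  have hR : R.card + 1 = numComponents s.A := by
    have hinj : Function.Injective out := fun K L h => by rw [← hout K, ← hout L, h]
    rw [Finset.card_image_of_injective _ hinj,
      Finset.card_erase_add_one (Finset.mem_univ _), Finset.card_univ, numComponents,
      Nat.card_eq_fintype_card]
  have hRC : ∀ x ∈ R, x ∉ s.comp w := by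
    intro x hx hxC
    obtain ⟨K, hK, rfl⟩ := Finset.mem_image.1 hx
    refine (Finset.mem_erase.1 hK).1 ?_
    rw [← hout K]
    exact (SimpleGraph.ConnectedComponent.sound (mem_comp.1 hxC)).symm
  have hdis : Disjoint R (s.comp w) := Finset.disjoint_left.2 hRC
  have hle : (R ∪ s.comp w).card ≤ numComponents (s.away w s.A) := by
    rw [numComponents, Nat.card_eq_fintype_card, ← Finset.card_univ]
    refine Finset.card_le_card_of_injOn (graphOf (s.away w s.A)).connectedComponentMk
      (fun _ _ => Finset.mem_coe.2 (Finset.mem_univ _)) ?_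
    intro x hx y hy hxy
    have hr : (graphOf (s.away w s.A)).Reachable x y :=
      SimpleGraph.ConnectedComponent.exact hxy
    rcases Finset.mem_union.1 (Finset.mem_coe.1 hx) with hx | hx
    · rcases Finset.mem_union.1 (Finset.mem_coe.1 hy) with hy | hy
      · obtain ⟨K, hK, rfl⟩ := Finset.mem_image.1 hx
        obtain ⟨L, hL, rfl⟩ := Finset.mem_image.1 hy
        have : K = L := by
          rw [← hout K, ← hout L]
          exact SimpleGraph.ConnectedComponent.sound
            (hr.mono (graphOf_mono fun f hf => (mem_away.1 hf).1))
        rw [this]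
      · exact eq_of_reachable_away hy hr.symm
    · exact (eq_of_reachable_away hx hr).symm
  rw [Finset.card_union_of_disjoint hdis] at hle
  omega

theorem mem_of_mem_tree {s : State G} {e : G.Dart} {T : Finset (Sym2 V)}
    (hT : s.IsSpanningTree e T) {f : Sym2 V} (hf : f ∈ T) {x : V} (hx : x ∈ f) :
    x ∈ (insert e.fst (s.comp e.snd : Set V) : Set V) := by
  rcases Finset.mem_insert.1 (hT.1 hf) with rfl | h
  · rcases e with ⟨⟨v, w⟩, h⟩
    rcases Sym2.mem_iff.1 hx with rfl | rfl
    · exact Set.mem_insert _ _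
    · exact Set.mem_insert_of_mem _ (self_mem_comp s _)
  · exact Set.mem_insert_of_mem _ ((mem_inside.1 h).2 x hx)

theorem ne_of_mem_tree {s : State G} {e : G.Dart} {T : Finset (Sym2 V)}
    (hT : s.IsSpanningTree e T) {x y : V} (hf : s(x, y) ∈ T) : x ≠ y := by
  have hG : s(x, y) ∈ G.edgeSet := by
    rcases Finset.mem_insert.1 (hT.1 hf) with h | h
    · rw [h]
      exact e.edge_mem
    · exact SimpleGraph.mem_edgeFinset.1 (s.E_subset (mem_inside.1 h).1)
  exact SimpleGraph.Adj.ne hG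

/-- The tree has one vertex more than the component, because `e.fst` lies outside it. The edges of
`T` are those of the induced graph, since none is a loop or leaves the vertex set. -/
theorem card_tree {s : State G} {e : G.Dart} {T : Finset (Sym2 V)}
    (hT : s.IsSpanningTree e T) (hj : ¬ s.Joined e.fst e.snd) :
    T.card = (s.comp e.snd).card := by
  classical
  have hv : e.fst ∉ s.comp e.snd := fun h => hj (mem_comp.1 h).symm
  have hcard := hT.2.card_edgeFinset
  have hV : Fintype.card (insert e.fst (s.comp e.snd : Set V) : Set V) =
      (s.comp e.snd).card + 1 := by
    rw [← Finset.card_insert_of_notMem hv, ← Fintype.card_coe]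
    refine Fintype.card_congr (Equiv.subtypeEquivRight fun x => ?_)
    rw [Set.mem_insert_iff, Finset.mem_insert, Finset.mem_coe]
  rw [hV, Nat.add_right_cancel_iff] at hcard
  rw [← hcard]
  symm
  refine Finset.card_bij (fun f _ => f.map Subtype.val) ?_ ?_ ?_
  · intro f hf
    induction f using Sym2.ind with | _ x y
    rw [SimpleGraph.mem_edgeFinset, SimpleGraph.mem_edgeSet] at hf
    exact (graphOf_adj.1 hf).1
  · intro f _ f' _ h
    exact Sym2.map.injective Subtype.val_injective h
  · intro f hf
    induction f using Sym2.ind with | _ x y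
    refine ⟨s(⟨x, mem_of_mem_tree hT hf (Sym2.mem_mk_left _ _)⟩,
      ⟨y, mem_of_mem_tree hT hf (Sym2.mem_mk_right _ _)⟩), ?_, rfl⟩
    rw [SimpleGraph.mem_edgeFinset, SimpleGraph.mem_edgeSet]
    exact graphOf_adj.2 ⟨hf, ne_of_mem_tree hT hf⟩

theorem disjoint_away_tree {s : State G} {e : G.Dart} {T : Finset (Sym2 V)}
    (hT : s.IsSpanningTree e T) : Disjoint (s.away e.snd s.E) T := by
  rw [Finset.disjoint_right]
  intro f hf hf'
  rcases Finset.mem_insert.1 (hT.1 hf) with rfl | h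
  · exact (mem_away.1 hf').2 e.snd (by rcases e with ⟨⟨v, w⟩, h⟩; exact Sym2.mem_mk_right _ _)
      (self_mem_comp s _)
  · induction f using Sym2.ind with | _ x y
    exact (mem_away.1 hf').2 x (Sym2.mem_mk_left _ _) ((mem_inside.1 h).2 x (Sym2.mem_mk_left _ _))

/-- The edges lost on a rejection: every edge at the component of `w` is incident to it, the edges
inside it twice, and `e` itself was not in `E`. -/
theorem card_touching {s : State G} {e : G.Dart} {Δ : ℕ} (hG : G.maxDegree ≤ Δ)
    (he : e.edge ∉ s.E) :
    (s.E \ s.away e.snd s.E).card + (s.inside e.snd).card + 1 ≤ Δ * (s.comp e.snd).card := by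
  classical
  have hcount : ∑ x ∈ s.comp e.snd, (G.edgeFinset.filter fun f => x ∈ f).card =
      ∑ f ∈ G.edgeFinset, ((s.comp e.snd).filter fun x => x ∈ f).card :=
    Finset.sum_card_bipartiteAbove_eq_sum_card_bipartiteBelow _
  have hdeg : ∑ x ∈ s.comp e.snd, (G.edgeFinset.filter fun f => x ∈ f).card ≤
      Δ * (s.comp e.snd).card := by
    rw [mul_comm, ← smul_eq_mul]
    refine Finset.sum_le_card_nsmul _ _ _ fun x _ => ?_
    refine le_trans (le_of_eq ?_) ((G.degree_le_maxDegree x).trans hG)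
    rw [← G.card_incidenceFinset_eq_degree, G.incidenceFinset_eq_filter]
  refine le_trans ?_ (hcount ▸ hdeg)
  have hsub : insert e.edge (s.E \ s.away e.snd s.E) ⊆ G.edgeFinset := by
    apply Finset.insert_subset _ (Finset.sdiff_subset.trans s.E_subset)
    rw [SimpleGraph.mem_edgeFinset]
    exact e.edge_mem
  have hnot : e.edge ∉ s.E \ s.away e.snd s.E := fun h => he (Finset.mem_sdiff.1 h).1
  have hins : s.inside e.snd ⊆ G.edgeFinset := fun f hf => s.E_subset (mem_inside.1 hf).1
  have h1 : (s.E \ s.away e.snd s.E).card + (s.inside e.snd).card + 1 =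
      ∑ f ∈ G.edgeFinset, ((if f ∈ insert e.edge (s.E \ s.away e.snd s.E) then 1 else 0) +
        (if f ∈ s.inside e.snd then 1 else 0)) := by
    rw [Finset.sum_add_distrib, Finset.sum_ite_mem, Finset.sum_ite_mem,
      Finset.inter_eq_right.2 hsub, Finset.inter_eq_right.2 hins, Finset.sum_const,
      Finset.sum_const, Finset.card_insert_of_notMem hnot]
    simp only [smul_eq_mul, mul_one]
    omega
  rw [h1]
  refine Finset.sum_le_sum fun f hf => ?_
  by_cases hin : f ∈ s.inside e.snd
  · have : 2 ≤ ((s.comp e.snd).filter fun x => x ∈ f).card := by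
      induction f using Sym2.ind with | _ x y
      have hxy : x ≠ y := SimpleGraph.Adj.ne (SimpleGraph.mem_edgeFinset.1 hf)
      rw [← Finset.card_pair hxy]
      refine Finset.card_le_card fun z hz => ?_
      have hz' : z ∈ s(x, y) := by simpa using hz
      exact Finset.mem_filter.2 ⟨(mem_inside.1 hin).2 z hz', hz'⟩
    rw [if_pos hin]
    split <;> omega
  · rw [if_neg hin]
    split
    · rename_i hmem
      rw [add_zero, Nat.one_le_iff_ne_zero, Finset.card_ne_zero]
      rcases Finset.mem_insert.1 hmem with rfl | h
      · exact ⟨e.snd, Finset.mem_filter.2 ⟨self_mem_comp s _, by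
          rcases e with ⟨⟨v, w⟩, h⟩; exact Sym2.mem_mk_right _ _⟩⟩
      · rw [Finset.mem_sdiff, mem_away] at h
        push Not at h
        obtain ⟨x, hx, hxC⟩ := h.2 h.1
        exact ⟨x, Finset.mem_filter.2 ⟨hxC, hx⟩⟩
    · simp

/-- All edges of `T` except possibly `e` lie inside the component, so `card_touching` bounds the
lost edges by (Δ - 1)|T|, and |T| edges return. The additive form avoids truncated subtraction. -/
theorem card_E_reject {s : State G} {e : G.Dart} {T S : Finset (Sym2 V)} {Δ : ℕ}
    (hG : G.maxDegree ≤ Δ) (he : e.edge ∉ s.E) (hj : ¬ s.Joined e.fst e.snd)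
    (hT : s.IsSpanningTree e T) (hS : S ⊆ T) :
    s.E.card + 2 * T.card ≤ (s.reject e T S hT hS).E.card + Δ * T.card := by
  have hm := card_tree hT hj
  have h1 := card_touching hG he
  have h2 : T.card ≤ (s.inside e.snd).card + 1 :=
    (Finset.card_le_card hT.1).trans (Finset.card_insert_le _ _)
  have h3 : (s.reject e T S hT hS).E.card = (s.away e.snd s.E).card + T.card :=
    Finset.card_union_of_disjoint (disjoint_away_tree hT)
  have h4 : (s.E \ s.away e.snd s.E).card + (s.away e.snd s.E).card = s.E.card :=
    Finset.card_sdiff_add_card_eq_card fun f hf => (mem_away.1 hf).1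
  rw [← hm] at h1
  omega

theorem numComponents_reject {s : State G} {e : G.Dart} {T S : Finset (Sym2 V)}
    (hj : ¬ s.Joined e.fst e.snd) (hT : s.IsSpanningTree e T) (hS : S ⊆ T) :
    numComponents s.A + T.card ≤ numComponents (s.reject e T S hT hS).A + S.card + 1 := by
  have h1 := numComponents_away s e.snd
  have h2 := numComponents_le_union (s.away e.snd s.A) S
  have h3 : (s.reject e T S hT hS).A = s.away e.snd s.A ∪ S := rfl
  rw [h3, card_tree hT hj]
  omega

/-- Each edge of a tree is a bridge: a walk in `S` would be a walk in the tree that avoids the edge.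
-/
theorem not_reachable_of_mem_tree {s : State G} {e : G.Dart} {T S : Finset (Sym2 V)}
    (hT : s.IsSpanningTree e T) (hS : S ⊆ T) {x y : V} (hf : s(x, y) ∈ T) (hfS : s(x, y) ∉ S) :
    ¬ (graphOf S).Reachable x y := by
  intro h
  let U : Set V := insert e.fst (s.comp e.snd : Set V)
  let H := (graphOf T).induce U
  have hx : x ∈ U := mem_of_mem_tree hT hf (Sym2.mem_mk_left _ _)
  have hy : y ∈ U := mem_of_mem_tree hT hf (Sym2.mem_mk_right _ _)
  have key : ∀ z, (graphOf S).Reachable x z →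
      ∃ hz : z ∈ U, (H.deleteEdges {s(⟨x, hx⟩, ⟨y, hy⟩)}).Reachable ⟨x, hx⟩ ⟨z, hz⟩ := by
    intro z hz
    rw [SimpleGraph.reachable_iff_reflTransGen] at hz
    induction hz with
    | refl => exact ⟨hx, .refl _⟩
    | @tail a b _ hab ih =>
      obtain ⟨ha, hr⟩ := ih
      obtain ⟨habS, hne⟩ := graphOf_adj.1 hab
      have hb : b ∈ U := mem_of_mem_tree hT (hS habS) (Sym2.mem_mk_right _ _)
      refine ⟨hb, hr.trans (SimpleGraph.Adj.reachable ?_)⟩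
      rw [SimpleGraph.deleteEdges_adj]
      refine ⟨graphOf_adj.2 ⟨hS habS, hne⟩, fun hmem => hfS ?_⟩
      have := congrArg (Sym2.map Subtype.val) (Set.mem_singleton_iff.1 hmem)
      simp only [Sym2.map_mk] at this
      rwa [← this]
  obtain ⟨hy', hr⟩ := key y h
  have hadj : H.Adj ⟨x, hx⟩ ⟨y, hy⟩ := graphOf_adj.2 ⟨hf, ne_of_mem_tree hT hf⟩
  have hb := SimpleGraph.isAcyclic_iff_forall_adj_isBridge.1 hT.2.isAcyclic hadj
  rw [SimpleGraph.isBridge_iff] at hb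
  exact hb hr

theorem numComponents_insert_tree {s : State G} {e : G.Dart} {T S : Finset (Sym2 V)}
    (hT : s.IsSpanningTree e T) (hS : S ⊆ T) {f : Sym2 V} (hf : f ∈ T) (hfS : f ∉ S) :
    numComponents (insert f S) + 1 ≤ numComponents S := by
  induction f using Sym2.ind with | _ x y
  exact numComponents_insert_of_not_reachable (not_reachable_of_mem_tree hT hS hf hfS)

end State

end Rejection

/-! ### Expectations under discrete laws -/

section Mean

variable {α β : Type*}

/-- The expectation of `f` under `μ`. -/
def mean (μ : PMF α) (f : α → ℝ≥0∞) : ℝ≥0∞ := ∑' a, μ a * f a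

theorem mean_pure (a : α) (f : α → ℝ≥0∞) : mean (PMF.pure a) f = f a := by
  classical
  rw [mean, tsum_eq_single a fun b hb => by simp [PMF.pure_apply, hb]]
  simp

theorem mean_bind (μ : PMF α) (g : α → PMF β) (f : β → ℝ≥0∞) :
    mean (μ.bind g) f = mean μ fun a => mean (g a) f := by
  simp only [mean, PMF.bind_apply, ← ENNReal.tsum_mul_right, ← ENNReal.tsum_mul_left]
  rw [ENNReal.tsum_comm]
  simp only [mul_assoc]

theorem mean_map (μ : PMF α) (g : α → β) (f : β → ℝ≥0∞) :
    mean (μ.map g) f = mean μ fun a => f (g a) := by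
  rw [PMF.map, mean_bind]
  simp only [Function.comp_apply, mean_pure]

theorem mean_const (μ : PMF α) (c : ℝ≥0∞) : mean μ (fun _ => c) = c := by
  rw [mean, ENNReal.tsum_mul_right, μ.tsum_coe, one_mul]

theorem mean_mono (μ : PMF α) {f g : α → ℝ≥0∞} (h : ∀ a, f a ≤ g a) : mean μ f ≤ mean μ g :=
  ENNReal.tsum_le_tsum fun a => mul_le_mul_right (h a) _

theorem mean_le (μ : PMF α) {f : α → ℝ≥0∞} {c : ℝ≥0∞} (h : ∀ a, f a ≤ c) : mean μ f ≤ c :=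
  (mean_mono μ h).trans_eq (mean_const μ c)

theorem mean_add (μ : PMF α) (f g : α → ℝ≥0∞) :
    mean μ (fun a => f a + g a) = mean μ f + mean μ g := by
  simp only [mean, mul_add, ENNReal.tsum_add]

theorem mean_const_mul (μ : PMF α) (c : ℝ≥0∞) (f : α → ℝ≥0∞) :
    mean μ (fun a => c * f a) = c * mean μ f := by
  simp only [mean, ← ENNReal.tsum_mul_left, mul_left_comm]

theorem mean_sum (μ : PMF α) {ι : Type*} (s : Finset ι) (f : ι → α → ℝ≥0∞) :
    mean μ (fun a => ∑ i ∈ s, f i a) = ∑ i ∈ s, mean μ (f i) := by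
  simp only [mean, Finset.mul_sum]
  exact Summable.tsum_finsetSum fun _ _ => ENNReal.summable

theorem mean_coin (r : ℝ) (h0 : 0 ≤ r) (h1 : r ≤ 1) (f : Bool → ℝ≥0∞) :
    mean (coin r h0 h1) f = ENNReal.ofReal r * f true + ENNReal.ofReal (1 - r) * f false := by
  rw [mean, tsum_bool, add_comm]
  simp [coin]

theorem lintegral_toMeasure [MeasurableSpace α] [DiscreteMeasurableSpace α] [Countable α]
    (μ : PMF α) (f : α → ℝ≥0∞) : ∫⁻ a, f a ∂μ.toMeasure = mean μ f := by
  rw [lintegral_countable']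
  simp only [PMF.toMeasure_apply_singleton _ _ (MeasurableSet.singleton _), mean, mul_comm]

end Mean

/-! ### The random cluster model on a forest -/

section Forest

variable {V : Type u} [DecidableEq V] {p q : ℝ} {T : Finset (Sym2 V)}

/-- Opening an edge replaces a factor 1 - p by p and loses at least one factor q, as it merges two
components. -/
theorem rcWeight_insert_le (hp0 : 0 ≤ p) (hp1 : p ≤ 1) (hq : 1 ≤ q) {S : Finset (Sym2 V)}
    {f : Sym2 V} (hf : f ∈ T) (hfS : f ∉ S)
    (hc : numComponents (insert f S) + 1 ≤ numComponents S) :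
    q * (1 - p) * rcWeight p q T (insert f S) ≤ p * rcWeight p q T S := by
  unfold rcWeight
  have h1 : (T \ S).card = (T \ insert f S).card + 1 := by
    rw [Finset.sdiff_insert, Finset.card_erase_add_one (Finset.mem_sdiff.2 ⟨hf, hfS⟩)]
  rw [Finset.card_insert_of_notMem hfS, h1, pow_succ, pow_succ]
  have h2 : q ^ (numComponents (insert f S) + 1) ≤ q ^ numComponents S :=
    pow_le_pow_right₀ hq hc
  have h3 : 0 ≤ 1 - p := by linarith
  have h4 : 0 ≤ p ^ S.card * p * (1 - p) ^ (T \ insert f S).card * (1 - p) := by positivity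
  have := mul_le_mul_of_nonneg_left h2 h4
  rw [pow_succ] at this
  linarith

theorem randomCluster_insert_le (hp0 : 0 ≤ p) (hp1 : p ≤ 1) (hq : 1 ≤ q) (hq' : 0 < q)
    {f : Sym2 V} (hf : f ∈ T) {S S' : {A : Finset (Sym2 V) // A ⊆ T}} (hfS : f ∉ S.1)
    (hS' : S'.1 = insert f S.1) (hc : numComponents S'.1 + 1 ≤ numComponents S.1) :
    ENNReal.ofReal (q * (1 - p)) * randomCluster p q hp0 hp1 hq' T S' ≤
      ENNReal.ofReal p * randomCluster p q hp0 hp1 hq' T S := by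
  unfold randomCluster
  rw [PMF.normalize_apply, PMF.normalize_apply, ← mul_assoc, ← mul_assoc,
    ← ENNReal.ofReal_mul (by nlinarith), ← ENNReal.ofReal_mul hp0]
  rw [hS'] at hc ⊢
  refine mul_le_mul_left (ENNReal.ofReal_le_ofReal ?_) _
  exact rcWeight_insert_le hp0 hp1 hq hf hfS hc

/-- In the random cluster model on a forest, an edge is open with probability at most
`p / (p + q (1 - p))`. -/
theorem mean_mem_le (hp0 : 0 ≤ p) (hp1 : p < 1) (hq : 1 ≤ q) (hq' : 0 < q)
    (hT : ∀ S ⊆ T, ∀ f ∈ T, f ∉ S → numComponents (insert f S) + 1 ≤ numComponents S)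
    {f : Sym2 V} (hf : f ∈ T) :
    mean (randomCluster p q hp0 hp1.le hq' T) (fun S => if f ∈ S.1 then 1 else 0) ≤
      ENNReal.ofReal (p / (p + q * (1 - p))) := by
  set μ := randomCluster p q hp0 hp1.le hq' T
  set x := mean μ fun S => if f ∈ S.1 then 1 else 0 with hx
  set y := mean μ fun S => if f ∈ S.1 then 0 else 1 with hy
  have hxy : x + y = 1 := by
    rw [hx, hy, ← mean_add]
    refine (congrArg (mean μ) (funext fun S => ?_)).trans (mean_const μ 1)
    split <;> simp
  have hcmp : ENNReal.ofReal (q * (1 - p)) * x ≤ ENNReal.ofReal p * y := by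
    rw [hx, hy, mean, mean, ← ENNReal.tsum_mul_left, ← ENNReal.tsum_mul_left]
    -- Toggling `f` pairs the configurations in which it is open with those in which it is closed,
    -- so that weights are compared pair by pair.
    let er : {A : Finset (Sym2 V) // A ⊆ T} → {A : Finset (Sym2 V) // A ⊆ T} := fun S =>
      if f ∈ S.1 then ⟨S.1.erase f, (Finset.erase_subset _ _).trans S.2⟩
      else ⟨insert f S.1, Finset.insert_subset hf S.2⟩
    have her : Function.Involutive er := by
      intro S
      by_cases h : f ∈ S.1 <;> simp [er, h]
    rw [← her.toPerm.tsum_eq fun S => ENNReal.ofReal p * (μ S * if f ∈ S.1 then 0 else 1)]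
    refine ENNReal.tsum_le_tsum fun S => ?_
    rw [Function.Involutive.coe_toPerm]
    by_cases h : f ∈ S.1
    · have h1 : (er S).1 = S.1.erase f := by simp [er, h]
      have h2 : f ∉ (er S).1 := by simp [h1]
      have h3 : S.1 = insert f (er S).1 := by rw [h1, Finset.insert_erase h]
      rw [if_pos h, if_neg h2, mul_one, mul_one]
      refine randomCluster_insert_le hp0 hp1.le hq hq' hf h2 h3 ?_
      rw [h3]
      exact hT _ (er S).2 f hf h2
    · simp [h]
  have hx1 : x ≠ ∞ := ne_top_of_le_ne_top ENNReal.one_ne_top (hxy ▸ le_self_add)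
  have hy1 : y ≠ ∞ := ne_top_of_le_ne_top ENNReal.one_ne_top (hxy ▸ le_add_self)
  have hk : 0 < q * (1 - p) := mul_pos hq' (by linarith)
  rw [← ENNReal.ofReal_toReal hx1, ← ENNReal.ofReal_toReal hy1, ← ENNReal.ofReal_mul hk.le,
    ← ENNReal.ofReal_mul hp0,
    ENNReal.ofReal_le_ofReal_iff (mul_nonneg hp0 ENNReal.toReal_nonneg)] at hcmp
  have hxy' : x.toReal + y.toReal = 1 := by
    rw [← ENNReal.toReal_add hx1 hy1, hxy, ENNReal.toReal_one]
  rw [← ENNReal.ofReal_toReal hx1]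
  apply ENNReal.ofReal_le_ofReal
  rw [le_div_iff₀ (by linarith)]
  have : y.toReal = 1 - x.toReal := by linarith
  rw [this] at hcmp
  linarith

theorem mean_card_le (hp0 : 0 ≤ p) (hp1 : p < 1) (hq : 1 ≤ q) (hq' : 0 < q)
    (hT : ∀ S ⊆ T, ∀ f ∈ T, f ∉ S → numComponents (insert f S) + 1 ≤ numComponents S) :
    mean (randomCluster p q hp0 hp1.le hq' T) (fun S => (S.1.card : ℝ≥0∞)) ≤
      ENNReal.ofReal (T.card * (p / (p + q * (1 - p)))) := by
  have h1 : (fun S : {A : Finset (Sym2 V) // A ⊆ T} => (S.1.card : ℝ≥0∞)) =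
      fun S => ∑ f ∈ T, if f ∈ S.1 then 1 else 0 := by
    ext S
    rw [Finset.sum_ite_mem, Finset.inter_eq_right.2 S.2]
    simp
  rw [h1, mean_sum, ENNReal.ofReal_mul (Nat.cast_nonneg _), ENNReal.ofReal_natCast,
    ← nsmul_eq_mul]
  exact Finset.sum_le_card_nsmul _ _ _ fun f hf => mean_mem_le hp0 hp1 hq hq' hT hf

theorem mean_affine_card_le (hp0 : 0 ≤ p) (hp1 : p < 1) (hq : 1 ≤ q) (hq' : 0 < q)
    (hT : ∀ S ⊆ T, ∀ f ∈ T, f ∉ S → numComponents (insert f S) + 1 ≤ numComponents S)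
    {c b : ℝ} (hc : 0 ≤ c) (hb : 0 ≤ b) :
    mean (randomCluster p q hp0 hp1.le hq' T) (fun S => ENNReal.ofReal (c + b * S.1.card)) ≤
      ENNReal.ofReal (c + b * (T.card * (p / (p + q * (1 - p))))) := by
  have h0 : 0 ≤ p / (p + q * (1 - p)) :=
    div_nonneg hp0 (add_nonneg hp0 (mul_nonneg hq'.le (by linarith)))
  have h1 : ∀ n : ℕ, ENNReal.ofReal (c + b * n) = ENNReal.ofReal c + ENNReal.ofReal b * n := by
    intro n
    rw [ENNReal.ofReal_add hc (by positivity), ENNReal.ofReal_mul hb, ENNReal.ofReal_natCast]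
  simp only [h1]
  rw [mean_add, mean_const, mean_const_mul, ENNReal.ofReal_add hc (by positivity),
    ENNReal.ofReal_mul hb]
  gcongr
  exact mean_card_le hp0 hp1 hq hq' hT

end Forest

/-! ### The potential and its mean decrease -/

section Drift

variable {V : Type u} [Fintype V] {G : SimpleGraph V} [DecidableRel G.Adj]

namespace State

/-- The number of edges that are still missing, plus `b` times the rank of the edges colored `1`. -/
def potential (b : ℝ) (s : State G) : ℝ :=
  G.edgeFinset.card - s.E.card + b * (Nat.card V - numComponents s.A)

theorem card_E_le (s : State G) : s.E.card ≤ G.edgeFinset.card := Finset.card_le_card s.E_subset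

theorem card_E_lt {s : State G} (hs : ¬ s.IsFinal) : s.E.card + 1 ≤ G.edgeFinset.card :=
  Finset.card_lt_card (s.E_subset.ssubset_of_ne hs)

theorem potential_init (b : ℝ) : (init : State G).potential b = G.edgeFinset.card := by
  simp [potential, init, numComponents_empty]

theorem rank_nonneg (A : Finset (Sym2 V)) : (0 : ℝ) ≤ Nat.card V - numComponents A :=
  sub_nonneg.2 (Nat.cast_le.2 (numComponents_le_card A))

theorem one_le_potential {b : ℝ} (hb : 0 ≤ b) {s : State G} (hs : ¬ s.IsFinal) :
    1 ≤ s.potential b := by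
  have h1 : ((s.E.card + 1 : ℕ) : ℝ) ≤ G.edgeFinset.card := Nat.cast_le.2 (card_E_lt hs)
  have h2 := mul_nonneg hb (rank_nonneg s.A)
  push_cast at h1
  unfold potential
  linarith

variable [DecidableEq V]

theorem card_E_accept {s : State G} {e : G.Dart} (he : e.edge ∉ s.E) (c : Bool) :
    ((s.accept e c).E.card : ℝ) = s.E.card + 1 := by
  exact_mod_cast Finset.card_insert_of_notMem he

theorem potential_accept_le {b : ℝ} (hb : 0 ≤ b) {s : State G} {e : G.Dart} {c : Bool} {n : ℕ}
    (he : e.edge ∉ s.E) (h : numComponents s.A ≤ numComponents (s.accept e c).A + n) :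
    (s.accept e c).potential b ≤ s.potential b - 1 + b * n := by
  have h1 : (numComponents s.A : ℝ) ≤ numComponents (s.accept e c).A + n := by exact_mod_cast h
  have h2 := mul_le_mul_of_nonneg_left h1 hb
  unfold potential
  rw [card_E_accept he]
  linarith

theorem potential_accept_joined_le {b : ℝ} (hb : 0 ≤ b) {s : State G} {e : G.Dart} {c : Bool}
    (he : e.edge ∉ s.E) (hj : s.Joined e.fst e.snd) :
    (s.accept e c).potential b ≤ s.potential b - 1 := by
  have h : numComponents s.A ≤ numComponents (s.accept e c).A + 0 := by
    cases c
    · exact le_rfl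
    · exact numComponents_insert_of_reachable hj
  simpa using potential_accept_le hb he h

theorem potential_accept_false_le {b : ℝ} (hb : 0 ≤ b) {s : State G} {e : G.Dart}
    (he : e.edge ∉ s.E) : (s.accept e false).potential b ≤ s.potential b - 1 := by
  have h : numComponents s.A ≤ numComponents (s.accept e false).A + 0 := le_rfl
  simpa using potential_accept_le hb he h

theorem potential_accept_true_le {b : ℝ} (hb : 0 ≤ b) {s : State G} {e : G.Dart}
    (he : e.edge ∉ s.E) : (s.accept e true).potential b ≤ s.potential b - 1 + b := by
  have h : numComponents s.A ≤ numComponents (s.accept e true).A + 1 :=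
    numComponents_le_insert _ _
  simpa using potential_accept_le hb he h

variable {b : ℝ} {Δ : ℕ} {s : State G} {e : G.Dart} {T : Finset (Sym2 V)}

theorem potential_reject_le (hb : 0 ≤ b) (hG : G.maxDegree ≤ Δ) (he : e.edge ∉ s.E)
    (hj : ¬ s.Joined e.fst e.snd) (hT : s.IsSpanningTree e T) {S : Finset (Sym2 V)} (hS : S ⊆ T) :
    (s.reject e T S hT hS).potential b ≤
      s.potential b + (Δ - 2) * T.card - b * (T.card - 1) + b * S.card := by
  have h1 : (s.E.card : ℝ) + 2 * T.card ≤ (s.reject e T S hT hS).E.card + Δ * T.card := by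
    exact_mod_cast card_E_reject hG he hj hT hS
  have h2 : (numComponents s.A : ℝ) + T.card ≤
      numComponents (s.reject e T S hT hS).A + S.card + 1 := by
    exact_mod_cast numComponents_reject hj hT hS
  have h3 := mul_le_mul_of_nonneg_left h2 hb
  unfold potential
  linarith

/-- The component of `w` alone contributes |T| - 1 to the rank. This keeps the bound on the
potential after a rejection nonnegative, so that `ENNReal.ofReal` does not truncate it. -/
theorem le_potential (hb : 0 ≤ b) (hj : ¬ s.Joined e.fst e.snd) (hT : s.IsSpanningTree e T) :
    b * (T.card - 1) ≤ s.potential b := by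
  have h1 := numComponents_away s e.snd
  rw [← card_tree hT hj] at h1
  have h2 : numComponents s.A + T.card ≤ Nat.card V + 1 :=
    h1.trans (Nat.add_le_add_right (numComponents_le_card _) 1)
  have h3 : (numComponents s.A : ℝ) + T.card ≤ Nat.card V + 1 := by exact_mod_cast h2
  have h4 : (s.E.card : ℝ) ≤ G.edgeFinset.card := Nat.cast_le.2 s.card_E_le
  have h5 := mul_le_mul_of_nonneg_left h3 hb
  unfold potential
  linarith

theorem mean_potential_reject_le {p q : ℝ} (hp0 : 0 ≤ p) (hp1 : p < 1) (hq : 1 ≤ q) (hq' : 0 < q)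
    (hΔ : 2 ≤ Δ) (hb : 0 ≤ b) (hbΔ : b * (1 - p / (p + q * (1 - p))) = Δ - 2)
    (hG : G.maxDegree ≤ Δ) (he : e.edge ∉ s.E) (hj : ¬ s.Joined e.fst e.snd)
    (hT : s.IsSpanningTree e T) :
    mean (randomCluster p q hp0 hp1.le hq' T)
      (fun S => ENNReal.ofReal ((s.reject e T S.1 hT S.2).potential b)) ≤
      ENNReal.ofReal (s.potential b + b) := by
  have hΔ' : (0 : ℝ) ≤ Δ - 2 := by
    have : (2 : ℝ) ≤ Δ := by exact_mod_cast hΔ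
    linarith
  have hc : 0 ≤ s.potential b + (Δ - 2) * T.card - b * (T.card - 1) := by
    have h1 := le_potential hb hj hT
    have h2 : (0 : ℝ) ≤ (Δ - 2) * T.card := by positivity
    linarith
  refine (mean_mono _ fun S => ENNReal.ofReal_le_ofReal
    (potential_reject_le hb hG he hj hT S.2)).trans ?_
  refine (mean_affine_card_le hp0 hp1 hq hq'
    (fun S hS f hf hfS => numComponents_insert_tree hT hS hf hfS) hc hb).trans (le_of_eq ?_)
  -- By the choice of `b` all terms in |T| cancel, and only `b` remains.
  rw [← hbΔ]
  congr 1
  ring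

end State

variable [DecidableEq V]

theorem mean_stepLaw_le {p q : ℝ} (hp0 : 0 ≤ p) (hp1 : p < 1) (hq : 1 < q) {Δ : ℕ} (hΔ : 2 ≤ Δ)
    {b : ℝ} (hb : 0 ≤ b) (hbΔ : b * (1 - p / (p + q * (1 - p))) = Δ - 2)
    (hG : G.maxDegree ≤ Δ) (R : ChoiceRule G) (n : ℕ) (h : History G n) (hfin : ¬ h.last.IsFinal) :
    mean (stepLaw p q hp0 hp1.le hq R n h) (fun s => ENNReal.ofReal (s.potential b)) ≤
      ENNReal.ofReal (h.last.potential b - (1 - p * (1 - 1 / q) - p * b)) := by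
  have hg := State.one_le_potential hb hfin
  set g := h.last.potential b
  have hq0 : 0 < q := by linarith
  have hr0 : 0 ≤ 1 / q := by positivity
  have hr1 : 1 / q ≤ 1 := (div_le_one hq0).2 hq.le
  rw [stepLaw, dif_neg hfin, mean_bind]
  -- The bound holds for each edge, and below for each tree, so the laws of these choices do not
  -- matter.
  refine mean_le _ fun e => ?_
  split
  · rename_i hj
    rw [mean_map]
    refine mean_le _ fun c => ENNReal.ofReal_le_ofReal ?_
    refine (State.potential_accept_joined_le hb e.2 hj).trans ?_
    have h1 := mul_nonneg hp0 hb
    have h2 := mul_nonneg hp0 (sub_nonneg.2 hr1)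
    linarith
  · rename_i hj
    rw [mean_bind, mean_coin, if_pos rfl, if_neg Bool.false_ne_true, mean_pure, mean_bind,
      mean_coin, if_pos rfl, if_neg Bool.false_ne_true, mean_pure, mean_bind]
    have h0 := State.potential_accept_false_le hb e.2
    have h1 := State.potential_accept_true_le hb e.2
    have h2 : mean (R.tree n h e.1 e.2 hj) (fun T => mean
        ((randomCluster p q hp0 hp1.le hq0 T.1).map fun S =>
          h.last.reject e.1 T.1 S.1 T.2 S.2) fun s => ENNReal.ofReal (s.potential b)) ≤
        ENNReal.ofReal (g + b) := by
      refine mean_le _ fun T => ?_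
      rw [mean_map]
      exact State.mean_potential_reject_le hp0 hp1 hq.le hq0 hΔ hb hbΔ hG e.2 hj T.2
    calc _ ≤ ENNReal.ofReal p * (ENNReal.ofReal (1 / q) * ENNReal.ofReal (g - 1 + b) +
          ENNReal.ofReal (1 - 1 / q) * ENNReal.ofReal (g + b)) +
          ENNReal.ofReal (1 - p) * ENNReal.ofReal (g - 1) := by gcongr
      _ = ENNReal.ofReal (p * (1 / q * (g - 1 + b) + (1 - 1 / q) * (g + b)) +
          (1 - p) * (g - 1)) := by
        -- Before termination an edge is missing, so `g` is at least 1 and no term is truncated by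
        -- `ENNReal.ofReal`.
        have k1 : 0 ≤ 1 / q * (g - 1 + b) := mul_nonneg hr0 (by linarith)
        have k2 : 0 ≤ (1 - 1 / q) * (g + b) := mul_nonneg (by linarith) (by linarith)
        have k3 : 0 ≤ (1 - p) * (g - 1) := mul_nonneg (by linarith) (by linarith)
        rw [← ENNReal.ofReal_mul hr0, ← ENNReal.ofReal_mul (sub_nonneg.2 hr1),
          ← ENNReal.ofReal_add k1 k2, ← ENNReal.ofReal_mul hp0,
          ← ENNReal.ofReal_mul (sub_nonneg.2 hp1.le), ← ENNReal.ofReal_add _ k3]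
        exact mul_nonneg hp0 (add_nonneg k1 k2)
      _ = _ := by
        congr 1
        ring

end Drift

/-! ### From mean decrease to expected running time -/

section Run

variable {V : Type u} [Fintype V] {G : SimpleGraph V} [DecidableRel G.Adj]

open Classical in
-- All times before the first final one are counted on the right; if there is none, the sum is
-- infinite.
theorem numSteps_le_tsum (ω : ℕ → State G) :
    numSteps ω ≤ ∑' n, if (ω n).IsFinal then (0 : ℝ≥0∞) else 1 := by
  by_cases h : ∃ n, (ω n).IsFinal
  · calc numSteps ω ≤ (Nat.find h : ℝ≥0∞) := iInf₂_le (f := fun n (_ : (ω n).IsFinal) => (n : ℝ≥0∞)) _ (Nat.find_spec h)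
      _ = ∑ n ∈ Finset.range (Nat.find h), if (ω n).IsFinal then (0 : ℝ≥0∞) else 1 := by
        rw [Finset.sum_congr rfl fun n hn =>
          if_neg (Nat.find_min h (Finset.mem_range.1 hn))]
        simp
      _ ≤ _ := ENNReal.sum_le_tsum _
  · push Not at h
    simp [h]

variable [DecidableEq V] {p q : ℝ} (hp0 : 0 ≤ p) (hp1 : p ≤ 1) (hq : 1 < q) (R : ChoiceRule G)

theorem lintegral_runLaw_zero (Ψ : State G → ℝ≥0∞) :
    ∫⁻ ω, Ψ (ω 0) ∂(runLaw p q hp0 hp1 hq R) = Ψ State.init := by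
  let κ := stepKernel p q hp0 hp1 hq R
  have hX : ∀ x₀ : History G 0, ∫⁻ ω, Ψ (ω 0) ∂(Kernel.traj (X := fun _ => State G) κ 0 x₀) =
      Ψ x₀.last := by
    intro x₀
    have h1 : ∫⁻ ω, Ψ (ω 0) ∂(Kernel.traj (X := fun _ => State G) κ 0 x₀) =
        ∫⁻ h : History G 0, Ψ h.last ∂((Kernel.traj (X := fun _ => State G) κ 0 x₀).map
          (Preorder.frestrictLe 0)) :=
      (lintegral_map (f := fun h : History G 0 => Ψ h.last) (measurable_of_countable _)
        (Preorder.measurable_frestrictLe (X := fun _ => State G) 0)).symm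
    rw [h1, Kernel.traj_map_frestrictLe_apply, Kernel.partialTraj_self, Kernel.id_apply,
      lintegral_dirac]
  let ι := (MeasurableEquiv.piUnique fun _ : Finset.Iic 0 => State G).symm
  have hd : (Measure.dirac State.init).map ι = Measure.dirac (ι State.init) :=
    Measure.map_dirac' ι.measurable _
  have hrun : runLaw p q hp0 hp1 hq R =
      Kernel.traj (X := fun _ => State G) κ 0 (ι State.init) := by
    refine (congrArg (fun μ => Measure.bind μ (Kernel.traj (X := fun _ => State G) κ 0))
      hd).trans (Measure.dirac_bind (Kernel.measurable _) _)
  rw [hrun]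
  exact hX _

/-- The joint law of the history and the next state is the law of the history composed with
`stepKernel`. -/
theorem lintegral_runLaw_succ (Ψ : State G → ℝ≥0∞) (n : ℕ) :
    ∫⁻ ω, Ψ (ω (n + 1)) ∂(runLaw p q hp0 hp1 hq R) =
      ∫⁻ ω, mean (stepLaw p q hp0 hp1 hq R n (Preorder.frestrictLe n ω)) Ψ
        ∂(runLaw p q hp0 hp1 hq R) := by
  have hm : Measurable (Preorder.frestrictLe (π := fun _ => State G) n) :=
    Preorder.measurable_frestrictLe (X := fun _ => State G) n
  have key := Kernel.map_frestrictLe_trajMeasure_compProd_eq_map_trajMeasure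
    (X := fun _ => State G) (μ₀ := Measure.dirac State.init)
    (κ := stepKernel p q hp0 hp1 hq R) (a := n)
  have h2 := congrArg (fun μ => ∫⁻ x : History G n × State G, Ψ x.2 ∂μ) key
  beta_reduce at h2
  rw [Measure.lintegral_compProd (measurable_of_countable _),
    lintegral_map (measurable_of_countable _) hm,
    lintegral_map (measurable_of_countable _) (by fun_prop)] at h2
  rw [runLaw, ← h2]
  refine lintegral_congr fun ω => ?_
  exact lintegral_toMeasure (stepLaw p q hp0 hp1 hq R n (Preorder.frestrictLe n ω)) Ψ

open Classical in
/-- If `Ψ` decreases by at least `d` in mean at each step before termination, then the expected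
number of steps is at most `Ψ State.init / d`. -/
theorem expectedSteps_le_of_drift (Ψ : State G → ℝ≥0∞) (d : ℝ≥0∞)
    (hΨ : ∀ (n : ℕ) (h : History G n), ¬ h.last.IsFinal →
      mean (stepLaw p q hp0 hp1 hq R n h) Ψ + d ≤ Ψ h.last) :
    d * expectedSteps p q hp0 hp1 hq R ≤ Ψ State.init := by
  set μ := runLaw p q hp0 hp1 hq R with hμ
  let g : State G → ℝ≥0∞ := fun s => if s.IsFinal then 0 else 1
  have hmeas : ∀ (F : State G → ℝ≥0∞) (n : ℕ), Measurable fun ω : ℕ → State G => F (ω n) :=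
    fun F n => (measurable_of_countable F).comp (measurable_pi_apply n)
  have hstep : ∀ (n : ℕ) (h : History G n),
      mean (stepLaw p q hp0 hp1 hq R n h) Ψ + d * g h.last ≤ Ψ h.last := by
    intro n h
    by_cases hfin : h.last.IsFinal
    · have h1 : g h.last = 0 := if_pos hfin
      rw [stepLaw, dif_pos hfin, mean_pure, h1, mul_zero, add_zero]
    · have h1 : g h.last = 1 := if_neg hfin
      rw [h1, mul_one]
      exact hΨ n h hfin
  -- The mean decrease telescopes; the remaining potential at time `N` stays on the left to carry
  -- the induction.
  have hsum : ∀ N : ℕ, d * ∑ n ∈ Finset.range N, ∫⁻ ω, g (ω n) ∂μ + ∫⁻ ω, Ψ (ω N) ∂μ ≤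
      Ψ State.init := by
    intro N
    induction N with
    | zero => simp [hμ, lintegral_runLaw_zero]
    | succ N ih =>
      refine le_trans ?_ ih
      rw [Finset.sum_range_succ, mul_add, add_assoc]
      refine add_le_add_right ?_ _
      rw [add_comm, hμ, lintegral_runLaw_succ, ← lintegral_const_mul _ (hmeas g N),
        ← lintegral_add_right _ ((hmeas g N).const_mul d)]
      exact lintegral_mono fun ω => hstep N (Preorder.frestrictLe N ω)
  have hle : expectedSteps p q hp0 hp1 hq R ≤ ∑' n, ∫⁻ ω, g (ω n) ∂μ := by
    rw [← lintegral_tsum fun n => (hmeas g n).aemeasurable]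
    exact lintegral_mono numSteps_le_tsum
  refine (mul_le_mul_right hle d).trans ?_
  rw [← ENNReal.tsum_mul_left]
  refine ENNReal.tsum_le_of_sum_range_le fun N => ?_
  rw [← Finset.mul_sum]
  exact le_self_add.trans (hsum N)

end Run

/-- The bound on `p` is the smaller root of `(1 - (Δ - 1) p) (1 - (1 - 1 / q) p)`. -/
theorem mul_lt_one_of_lt_root {q : ℝ} (hq : 1 < q) {Δ : ℕ} (hΔ : 2 ≤ Δ) {p : ℝ}
    (hp : p < ((Δ : ℝ) - 1 / q -
        Real.sqrt (((Δ : ℝ) - 1 / q) ^ 2 - 4 * (1 - 1 / q) * ((Δ : ℝ) - 1))) /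
      (2 * (1 - 1 / q) * ((Δ : ℝ) - 1))) : p * ((Δ : ℝ) - 1) < 1 := by
  have hΔ' : (2 : ℝ) ≤ Δ := by exact_mod_cast hΔ
  have hr0 : 0 < 1 / q := by positivity
  have hr1 : 1 / q < 1 := (div_lt_one (by linarith)).2 hq
  -- The discriminant is a perfect square, so the bound on p is simply 1 / (Δ - 1).
  have hs : ((Δ : ℝ) - 1 / q) ^ 2 - 4 * (1 - 1 / q) * ((Δ : ℝ) - 1) =
      ((Δ : ℝ) - 2 + 1 / q) ^ 2 := by ring
  have hpos : 0 < (1 - 1 / q) * ((Δ : ℝ) - 1) := mul_pos (by linarith) (by linarith)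
  rw [hs, Real.sqrt_sq (by linarith), lt_div_iff₀ (by linarith)] at hp
  have h1 : p * ((Δ : ℝ) - 1) * (2 * (1 - 1 / q)) < 1 * (2 * (1 - 1 / q)) := by linarith
  exact lt_of_mul_lt_mul_right h1 (by linarith)

end RandomCluster

end

/-! ### Choice of the constants -/

theorem theorem4 (q : ℝ) (hq : 1 < q) (Δ : ℕ) (hΔ : 2 ≤ Δ) (p : ℝ) (hp0 : 0 ≤ p) (hp1 : p ≤ 1)
    (hp : p < ((Δ : ℝ) - 1 / q -
        Real.sqrt (((Δ : ℝ) - 1 / q) ^ 2 - 4 * (1 - 1 / q) * ((Δ : ℝ) - 1))) /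
      (2 * (1 - 1 / q) * ((Δ : ℝ) - 1))) :
    ∃ C : NNReal, ∀ (V : Type*) [Fintype V] [DecidableEq V] (G : SimpleGraph V)
      [DecidableRel G.Adj], G.maxDegree ≤ Δ →
      ∀ R : RandomCluster.ChoiceRule G,
        RandomCluster.expectedSteps p q hp0 hp1 hq R ≤ C * (G.edgeFinset.card : ENNReal) := by
  have hroot := RandomCluster.mul_lt_one_of_lt_root hq hΔ hp
  have hΔ' : (2 : ℝ) ≤ Δ := by exact_mod_cast hΔ
  have hr0 : 0 < 1 / q := by positivity
  have hr1 : 1 / q < 1 := (div_lt_one (by linarith)).2 hq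
  have hp1' : p < 1 := by nlinarith
  have hp1'' : 0 < 1 - p := by linarith
  have hps : 0 < 1 - p * (1 - 1 / q) := by nlinarith
  -- The solution of b(1 - θ) = Δ - 2, because 1 - θ = (1 - p) / (1 - p(1 - 1/q)).
  obtain ⟨b, hbdef⟩ : ∃ b : ℝ, b = (Δ - 2) * (1 - p * (1 - 1 / q)) / (1 - p) := ⟨_, rfl⟩
  have hb : 0 ≤ b := by
    rw [hbdef]
    exact div_nonneg (mul_nonneg (by linarith) hps.le) hp1''.le
  have hbΔ : b * (1 - p / (p + q * (1 - p))) = Δ - 2 := by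
    have h1 : p + q * (1 - p) = q * (1 - p * (1 - 1 / q)) := by
      field_simp
      ring
    have h2 : 1 - p / (p + q * (1 - p)) = (1 - p) / (1 - p * (1 - 1 / q)) := by
      have h3 : 0 < p + q * (1 - p) := by
        rw [h1]
        exact mul_pos (by linarith) hps
      rw [one_sub_div h3.ne', add_sub_cancel_left, h1, mul_div_mul_left _ _ (by linarith)]
    rw [h2, hbdef, div_mul_div_cancel₀ hp1''.ne', mul_div_cancel_right₀ _ hps.ne']
  obtain ⟨δ, hδdef⟩ : ∃ δ : ℝ, δ = 1 - p * (1 - 1 / q) - p * b := ⟨_, rfl⟩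
  have hδ : 0 < δ := by
    have h1 : δ = (1 - p * (1 - 1 / q)) * ((1 - p * (Δ - 1)) / (1 - p)) := by
      rw [hδdef, hbdef]
      field_simp
      ring
    rw [h1]
    exact mul_pos hps (div_pos (by linarith) hp1'')
  -- With a potential of at least 1 before termination, this makes the subtraction of `δ` exact in
  -- `ENNReal`.
  have hδ1 : δ ≤ 1 := by
    have h1 := mul_nonneg hp0 hb
    have h2 : 0 ≤ p * (1 - 1 / q) := mul_nonneg hp0 (by linarith)
    linarith
  refine ⟨(Real.toNNReal δ)⁻¹, fun V _ _ G _ hG R => ?_⟩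
  have hdrift := RandomCluster.expectedSteps_le_of_drift hp0 hp1 hq R
    (fun s => ENNReal.ofReal (s.potential b)) (ENNReal.ofReal δ) fun n h hfin => by
      have h1 := RandomCluster.mean_stepLaw_le hp0 hp1' hq hΔ hb hbΔ hG R n h hfin
      have h2 := RandomCluster.State.one_le_potential hb hfin
      rw [← hδdef] at h1
      refine (add_le_add_left h1 _).trans (le_of_eq ?_)
      rw [← ENNReal.ofReal_add (by linarith) hδ.le, sub_add_cancel]
  rw [RandomCluster.State.potential_init, ENNReal.ofReal_natCast] at hdrift
  have hδ0 : ENNReal.ofReal δ ≠ 0 := (ENNReal.ofReal_pos.2 hδ).ne'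
  rw [ENNReal.coe_inv (Real.toNNReal_pos.2 hδ).ne']
  calc RandomCluster.expectedSteps p q hp0 hp1 hq R
      = (ENNReal.ofReal δ)⁻¹ * (ENNReal.ofReal δ * RandomCluster.expectedSteps p q hp0 hp1 hq R) := by
        rw [← mul_assoc, ENNReal.inv_mul_cancel hδ0 ENNReal.ofReal_ne_top, one_mul]
    _ ≤ _ := mul_le_mul_right hdrift _
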